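/- **Theorem 1.2.** Let $\varphi:[0,\infty)\to\mathbb R$ be smooth with $\varphi(r)>0$ for $r>0$, $\varphi(0)=0$, $\varphi'(0)=1$, and with all derivatives of even order vanishing at $0$, so that the metric $g=dr^2+\varphi(r)^2\,d\theta^2$, written in polar coordinates $(r,\theta)$ of $\mathbb R^2$, extends smoothly to the origin. Let $K=-\varphi''/\varphi$ be its curvature, and let $$\Delta=\frac{\partial^2}{\partial r^2}+\frac{\varphi'}{\varphi}\frac{\partial}{\partial r}+\frac1{\varphi^2}\frac{\partial^2}{\partial\theta^2}$$ be its Laplacian, extended continuously to the origin. Suppose that $$K\ \ge\ -\frac{1}{r^2\log r}$$ outside some compact subset of $\mathbb R^2$, and that $\varphi(r)\to\infty$ as $r\to\infty$. Then every bounded biharmonic function is constant: if $u:\mathbb R^2\to\mathbb R$ is bounded, $u$ and $\Delta u$ are of class $C^2$ on $\mathbb R^2$, and $\Delta^2u=\Delta(\Delta u)=0$ on $\mathbb R^2$, then $u$ is constant. -/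

import Mathlib

open Set Filter Topology

noncomputable section

namespace RotSym

/-- The plane `ℝ²`, with Cartesian coordinates `p 0`, `p 1`; its polar radius is `r = ‖p‖`. -/
abbrev Plane : Type := EuclideanSpace ℝ (Fin 2)

/-- The rotation of the plane about the origin by the angle `t`. -/
def rot (t : ℝ) (p : Plane) : Plane :=
  !₂[Real.cos t * p 0 - Real.sin t * p 1, Real.sin t * p 0 + Real.cos t * p 1]

/-- The profiles `φ` for which `g = dr² + φ(r)² dθ²` is a Riemannian metric on the punctured plane
that extends smoothly to the origin: `φ` is smooth on `[0, ∞)` and positive on `(0, ∞)`,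
`φ(0) = 0`, `φ'(0) = 1`, and all derivatives of even order vanish at `0`
(derivatives at `0` are one-sided). -/
structure IsSmoothProfile (φ : ℝ → ℝ) : Prop where
  contDiffOn : ContDiffOn ℝ (⊤ : ℕ∞) φ (Ici 0)
  pos : ∀ r : ℝ, 0 < r → 0 < φ r
  map_zero : φ 0 = 0
  deriv_zero : derivWithin φ (Ici 0) 0 = 1
  even_deriv_zero : ∀ k : ℕ, iteratedDerivWithin (2 * k) φ (Ici 0) 0 = 0

/-- The curvature `K = -φ''/φ` of `dr² + φ(r)² dθ²`, at distance `r > 0` from the origin. -/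
def curvature (φ : ℝ → ℝ) (r : ℝ) : ℝ :=
  -(deriv (deriv φ) r / φ r)

/-- The polar partial derivative `∂u/∂r` at a point `p ≠ 0`: the derivative of `u` along the unit
speed parametrization `s ↦ s • (p / ‖p‖)` of the ray through `p`, at `s = ‖p‖`. -/
def dr (u : Plane → ℝ) (p : Plane) : ℝ :=
  deriv (fun s : ℝ => u ((s / ‖p‖) • p)) ‖p‖

/-- The polar partial derivative `∂u/∂θ` at `p`: the derivative of `u` along the rotations. -/
def dθ (u : Plane → ℝ) (p : Plane) : ℝ :=
  deriv (fun t : ℝ => u (rot t p)) 0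

/-- `∂²u/∂r² + (φ'/φ) ∂u/∂r + (1/φ²) ∂²u/∂θ²`, at a point `p ≠ 0` with `r = ‖p‖`. -/
def polarLaplacian (φ : ℝ → ℝ) (u : Plane → ℝ) (p : Plane) : ℝ :=
  dr (dr u) p + deriv φ ‖p‖ / φ ‖p‖ * dr u p + 1 / φ ‖p‖ ^ 2 * dθ (dθ u) p

open Classical in
/-- The Laplacian of `g = dr² + φ(r)² dθ²` on the whole plane: the polar expression away from the
origin, extended to the origin as a limit (which exists when `u` is `C²` and `φ` is a smooth
profile). -/
def laplacian (φ : ℝ → ℝ) (u : Plane → ℝ) (p : Plane) : ℝ :=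
  if p = 0 then limUnder (𝓝[≠] (0 : Plane)) (polarLaplacian φ u) else polarLaplacian φ u p

/-- `u` is biharmonic, `Δ²u = 0` on all of `ℝ²`, in the classical sense: `u` and `Δu` are `C²`
(as is the case for every `C⁴` function `u`), and `Δ(Δu) = 0`. -/
structure IsBiharmonic (φ : ℝ → ℝ) (u : Plane → ℝ) : Prop where
  contDiff : ContDiff ℝ 2 u
  contDiff_laplacian : ContDiff ℝ 2 (laplacian φ u)
  laplacian_laplacian : ∀ p : Plane, laplacian φ (laplacian φ u) p = 0

end RotSym

end

/-!
The metric `dr² + φ² dθ²` is conformal to a flat one: with `T' = 1/φ` it is `φ² (dT² + dθ²)`, so that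
`φ² Δ = (φ ∂_r)² + ∂_θ²`. Comparing `φ` with `r log r`, the profile of curvature
`-1 / (r² log r)`, gives `φ ≤ C r log r` near infinity, hence `T → ∞`: the surface is parabolic
(`IsSmoothProfile.exists_isConformalRadius`). At the origin `φ ≤ 2 r` gives `T → -∞`.

Pairing `u` and `v = Δu` with `cos (kθ + α)` on the circles about the origin turns `Δv = 0` and
`Δu = v` into ordinary differential equations for the modes `u_k`, `v_k`
(`isRadialSolution_mode`):
`φ (φ v_k')' - k² v_k = 0` and `φ (φ u_k')' - k² u_k = φ² v_k`.
Since `v` is bounded near the origin, `v_k = a exp (k T)` (`IsRadialSolution.eq_mul_exp`). If `a` were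
nonzero, say positive, then `P = exp (-k T) (φ u_k' + k u_k)` would have derivative `a φ`, which tends
to infinity; so `P ≥ 1` eventually, and `u_k` would grow at least like `T` for `k = 0` and like
`exp (k T)` for `k > 0`, against the boundedness of `u`
(`IsRadialSolution.false_of_pos`). Hence `a = 0`, and `u_k` solves the homogeneous equation as well:
it is a multiple of `exp (k T)`, which is bounded at infinity only if it is constant, and zero when
`k > 0`. A continuous function on a circle without modes of nonzero frequency is constant
(`eq_mean_of_integral_mul_cos_eq_zero`), so `u` is equal to its mean over circles, which does not
depend on the radius.
-/

noncomputable section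

namespace RotSym

/-! ### First order comparison on half-lines -/

lemma exists_const_of_hasDerivAt_zero {F : ℝ → ℝ} (h : ∀ r, 0 < r → HasDerivAt F 0 r) :
    ∃ c, ∀ r, 0 < r → F r = c :=
  isOpen_Ioi.exists_is_const_of_deriv_eq_zero isPreconnected_Ioi
    (fun r hr => (h r hr).differentiableAt.differentiableWithinAt) (fun r hr => (h r hr).deriv)

lemma monotoneOn_of_hasDerivAt_nonneg {F F' : ℝ → ℝ} {S : Set ℝ} (hS : Convex ℝ S)
    (h : ∀ r ∈ S, HasDerivAt F (F' r) r) (h0 : ∀ r ∈ S, 0 ≤ F' r) : MonotoneOn F S := by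
  refine monotoneOn_of_deriv_nonneg hS (fun r hr => (h r hr).continuousAt.continuousWithinAt)
    (fun r hr => (h r (interior_subset hr)).differentiableAt.differentiableWithinAt) fun r hr => ?_
  rw [(h r (interior_subset hr)).deriv]
  exact h0 r (interior_subset hr)

/-- If `F' ≤ G'` on `[R, ∞)`, then `G - F` is bounded below there, so `G` inherits the divergence
of `F`. -/
lemma tendsto_atTop_of_hasDerivAt_le {F G F' G' : ℝ → ℝ} {R : ℝ}
    (hF : ∀ r, R ≤ r → HasDerivAt F (F' r) r) (hG : ∀ r, R ≤ r → HasDerivAt G (G' r) r)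
    (hle : ∀ r, R ≤ r → F' r ≤ G' r) (hlim : Tendsto F atTop atTop) :
    Tendsto G atTop atTop := by
  have hmono : MonotoneOn (fun r => G r - F r) (Ici R) :=
    monotoneOn_of_hasDerivAt_nonneg (convex_Ici R) (fun r hr => (hG r hr).sub (hF r hr))
      fun r hr => sub_nonneg.2 (hle r hr)
  refine tendsto_atTop_mono' atTop ?_ (tendsto_atTop_add_const_right atTop (G R - F R) hlim)
  filter_upwards [eventually_ge_atTop R] with r hr
  have := hmono self_mem_Ici hr hr
  simp only at this
  linarith

lemma eq_zero_of_abs_mul_add_le {ι : Type*} {l : Filter ι} [l.NeBot] {X : ι → ℝ} {b c M : ℝ}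
    (hX : Tendsto X l atTop) (h : ∀ᶠ i in l, |b * X i + c| ≤ M) : b = 0 := by
  by_contra hb
  have h1 : Tendsto (fun i => |b| * X i) l atTop := hX.const_mul_atTop (abs_pos.2 hb)
  obtain ⟨i, hi, hi1, hi2⟩ :=
    (h.and ((h1.eventually_gt_atTop (M + |c|)).and (hX.eventually_ge_atTop 0))).exists
  have h2 : |b| * X i ≤ |b * X i + c| + |c| := by
    rw [← abs_of_nonneg hi2, ← abs_mul, abs_of_nonneg hi2]
    have := abs_sub (b * X i + c) c
    simpa using this
  linarith

/-! ### The radial equation -/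

/-- `T` is a radial conformal coordinate for `dr² + φ(r)² dθ²`: with `T' = 1/φ` the metric is
`φ² (dT² + dθ²)`. The two limits express that the punctured plane is conformal to the
whole cylinder: the origin is a removed point, and the surface is parabolic. -/
structure IsConformalRadius (φ T : ℝ → ℝ) : Prop where
  hasDerivAt : ∀ r, 0 < r → HasDerivAt T (1 / φ r) r
  tendsto_zero : Tendsto T (𝓝[>] 0) atBot
  tendsto_atTop : Tendsto T atTop atTop

/-- The function `f` on `(0, ∞)` is twice differentiable, and
`φ (φ f')' - k² f = φ² g`: this is the equation `Δ(f(r) h(θ)) = g(r) h(θ)` for `h'' = -k² h`. -/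
structure IsRadialSolution (φ : ℝ → ℝ) (k : ℝ) (f g : ℝ → ℝ) : Prop where
  differentiableAt : ∀ r, 0 < r → DifferentiableAt ℝ f r
  differentiableAt_deriv : ∀ r, 0 < r → DifferentiableAt ℝ (deriv f) r
  equation : ∀ r, 0 < r →
    φ r ^ 2 * deriv (deriv f) r + φ r * deriv φ r * deriv f r - k ^ 2 * f r = φ r ^ 2 * g r

variable {φ T : ℝ → ℝ} {k : ℝ} {f g : ℝ → ℝ}

lemma hasDerivAt_exp_mul (hT : ∀ r, 0 < r → HasDerivAt T (1 / φ r) r) (c : ℝ) {r : ℝ}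
    (hr : 0 < r) :
    HasDerivAt (fun r => Real.exp (c * T r)) (Real.exp (c * T r) * (c * (1 / φ r))) r :=
  ((hT r hr).const_mul c).exp

/-- The factorization `φ (φ f')' - k² f = (φ d/dr - k) (φ f' + k f)`, with the first order factor
integrated by `exp (-k T)`. -/
lemma IsRadialSolution.hasDerivAt_factor (hf : IsRadialSolution φ k f g)
    (hpos : ∀ r, 0 < r → 0 < φ r) (hd : ∀ r, 0 < r → DifferentiableAt ℝ φ r)
    (hT : ∀ r, 0 < r → HasDerivAt T (1 / φ r) r) {r : ℝ} (hr : 0 < r) :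
    HasDerivAt (fun r => (φ r * deriv f r + k * f r) * Real.exp (-k * T r))
      (φ r * g r * Real.exp (-k * T r)) r := by
  have h := ((((hd r hr).hasDerivAt.mul (hf.differentiableAt_deriv r hr).hasDerivAt)).add
    ((hf.differentiableAt r hr).hasDerivAt.const_mul k)).mul (hasDerivAt_exp_mul hT (-k) hr)
  refine h.congr_deriv ?_
  have h0 := (hpos r hr).ne'
  have e := hf.equation r hr
  have e' : φ r * g r = φ r * deriv (deriv f) r + deriv φ r * deriv f r - k ^ 2 * f r / φ r := by
    field_simp
    linear_combination -e
  rw [e']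
  simp only [Pi.add_apply, Pi.mul_apply]
  field_simp
  ring

lemma IsRadialSolution.neg_exponent (hf : IsRadialSolution φ k f g) :
    IsRadialSolution φ (-k) f g :=
  ⟨hf.1, hf.2, fun r hr => by rw [neg_sq]; exact hf.3 r hr⟩

lemma IsRadialSolution.neg (hf : IsRadialSolution φ k f g) :
    IsRadialSolution φ k (fun r => -f r) (fun r => -g r) := by
  have h1 : deriv (fun r => -f r) = fun r => -deriv f r := by
    funext r; exact deriv.fun_neg
  refine ⟨fun r hr => (hf.1 r hr).neg, fun r hr => ?_, fun r hr => ?_⟩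
  · rw [h1]; exact (hf.2 r hr).neg
  · rw [h1, deriv.fun_neg]
    linear_combination -hf.3 r hr

/-- Of the two homogeneous solutions `exp (±k T)` (`1` and `T` if `k = 0`), only the first stays
bounded at the origin. -/
lemma IsRadialSolution.eq_mul_exp (hf : IsRadialSolution φ k f 0) (hk : 0 ≤ k)
    (hpos : ∀ r, 0 < r → 0 < φ r) (hd : ∀ r, 0 < r → DifferentiableAt ℝ φ r)
    (hT : IsConformalRadius φ T) {M : ℝ} (hM : ∀ᶠ r in 𝓝[>] (0 : ℝ), |f r| ≤ M) :
    ∃ a, ∀ r, 0 < r → f r = a * Real.exp (k * T r) := by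
  obtain ⟨a, ha⟩ := exists_const_of_hasDerivAt_zero (fun r hr => by
    simpa using hf.hasDerivAt_factor hpos hd hT.hasDerivAt hr)
  obtain ⟨b, hb⟩ := exists_const_of_hasDerivAt_zero (fun r hr => by
    simpa using hf.neg_exponent.hasDerivAt_factor hpos hd hT.hasDerivAt hr)
  have hr0 : ∀ᶠ r in 𝓝[>] (0 : ℝ), 0 < r := eventually_mem_nhdsWithin
  rcases hk.eq_or_lt with rfl | hk
  · simp only [neg_zero, zero_mul, Real.exp_zero, mul_one, add_zero] at ha ⊢
    obtain ⟨c, hc⟩ := exists_const_of_hasDerivAt_zero (F := fun r => f r - a * T r) fun r hr => by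
      refine ((hf.1 r hr).hasDerivAt.sub ((hT.hasDerivAt r hr).const_mul a)).congr_deriv ?_
      rw [← ha r hr]
      have := (hpos r hr).ne'
      field_simp
      ring
    have h0 : -a = 0 := by
      refine eq_zero_of_abs_mul_add_le (c := c) (M := M)
        (tendsto_neg_atBot_atTop.comp hT.tendsto_zero) ?_
      filter_upwards [hr0, hM] with r hr hm
      have : -a * (Neg.neg ∘ T) r + c = f r := by
        rw [← hc r hr]; simp
      rwa [this]
    refine ⟨c, fun r hr => ?_⟩
    rw [← hc r hr, neg_eq_zero.1 h0]
    simp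
  · have hA : ∀ r, 0 < r → φ r * deriv f r + k * f r = a * Real.exp (k * T r) := by
      intro r hr
      rw [← ha r hr, mul_assoc, ← Real.exp_add]
      simp
    have hB : ∀ r, 0 < r → φ r * deriv f r - k * f r = b * Real.exp (-k * T r) := by
      intro r hr
      rw [← hb r hr, mul_assoc, ← Real.exp_add]
      simp [sub_eq_add_neg]
    have h0 : b = 0 := by
      refine eq_zero_of_abs_mul_add_le (c := 0) (M := 2 * k * M + |a|)
        (X := fun r => Real.exp (-k * T r)) (l := 𝓝[>] (0 : ℝ))
        (Real.tendsto_exp_atTop.comp (hT.tendsto_zero.const_mul_atBot_of_neg (by linarith))) ?_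
      filter_upwards [hr0, hM, hT.tendsto_zero.eventually_le_atBot 0] with r hr hm ht
      have he : b * Real.exp (-k * T r) + 0 = a * Real.exp (k * T r) - 2 * k * f r := by
        linarith [hA r hr, hB r hr]
      have h1 : Real.exp (k * T r) ≤ 1 :=
        Real.exp_le_one_iff.2 (mul_nonpos_of_nonneg_of_nonpos hk.le ht)
      rw [he]
      calc |a * Real.exp (k * T r) - 2 * k * f r|
          ≤ |a * Real.exp (k * T r)| + |2 * k * f r| := abs_sub _ _
        _ ≤ |a| * 1 + 2 * k * M := by
          rw [abs_mul, abs_mul, abs_of_pos (by positivity : 0 < 2 * k), abs_of_pos (Real.exp_pos _)]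
          gcongr
        _ = _ := by ring
    refine ⟨a / (2 * k), fun r hr => ?_⟩
    have h1 := hA r hr
    have h2 := hB r hr
    rw [h0, zero_mul] at h2
    field_simp
    linarith

/-- The resonant source `a exp (k T)` with `a > 0` forces `f` to be unbounded: the quantity
`P = (φ f' + k f) exp (-k T)` has derivative `a φ → ∞`, so `P ≥ 1` eventually, and then
`f exp (k T)` grows at least as fast as `∫ exp (2 k T) dT`. -/
lemma IsRadialSolution.false_of_pos {a : ℝ} (ha : 0 < a)
    (hf : IsRadialSolution φ k f fun r => a * Real.exp (k * T r)) (hk : 0 ≤ k)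
    (hpos : ∀ r, 0 < r → 0 < φ r) (hd : ∀ r, 0 < r → DifferentiableAt ℝ φ r)
    (hT : IsConformalRadius φ T) (hinf : Tendsto φ atTop atTop) {M : ℝ}
    (hM : ∀ r, 0 < r → |f r| ≤ M) : False := by
  set P := fun r => (φ r * deriv f r + k * f r) * Real.exp (-k * T r) with hP
  have hPd : ∀ r, 0 < r → HasDerivAt P (a * φ r) r := fun r hr => by
    refine (hf.hasDerivAt_factor hpos hd hT.hasDerivAt hr).congr_deriv ?_
    rw [mul_assoc, mul_assoc, ← Real.exp_add]
    simp [mul_comm]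
  obtain ⟨R, hR⟩ := eventually_atTop.1
    (((hinf.const_mul_atTop ha).eventually_ge_atTop 1).and (eventually_gt_atTop (0 : ℝ)))
  have hPlim : Tendsto P atTop atTop :=
    tendsto_atTop_of_hasDerivAt_le (F := id) (F' := fun _ => 1) (R := R)
      (fun r _ => hasDerivAt_id r) (fun r hr => hPd r (hR r hr).2) (fun r hr => (hR r hr).1)
      tendsto_id
  obtain ⟨S, hS⟩ := eventually_atTop.1
    ((hPlim.eventually_ge_atTop 1).and (eventually_gt_atTop (0 : ℝ)))
  have hE : ∀ r, 0 < r → HasDerivAt (fun r => f r * Real.exp (k * T r))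
      (Real.exp (2 * k * T r) * (1 / φ r) * P r) r := fun r hr => by
    refine ((hf.1 r hr).hasDerivAt.mul (hasDerivAt_exp_mul hT.hasDerivAt k hr)).congr_deriv ?_
    have h1 : Real.exp (2 * k * T r) * Real.exp (-k * T r) = Real.exp (k * T r) := by
      rw [← Real.exp_add]; congr 1; ring
    have h2 := (hpos r hr).ne'
    calc _ = Real.exp (k * T r) * (1 / φ r) * (φ r * deriv f r + k * f r) := by
          field_simp
      _ = _ := by rw [← h1, hP]; ring
  have hle : ∀ r, S ≤ r → Real.exp (2 * k * T r) * (1 / φ r)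
      ≤ Real.exp (2 * k * T r) * (1 / φ r) * P r := fun r hr => by
    have := hpos r (hS r hr).2
    exact le_mul_of_one_le_right (by positivity) (hS r hr).1
  rcases hk.eq_or_lt with rfl | hk
  · have hlim := tendsto_atTop_of_hasDerivAt_le (R := S) (fun r hr => hT.hasDerivAt r (hS r hr).2)
      (fun r hr => hE r (hS r hr).2) (fun r hr => by simpa using hle r hr) hT.tendsto_atTop
    obtain ⟨r, hr, hr0⟩ := ((hlim.eventually_gt_atTop M).and (eventually_gt_atTop 0)).exists
    have := (le_abs_self _).trans (hM r hr0)
    simp at hr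
    linarith
  · -- The multiple of `exp (k T)` absorbs the bound on `f`, so the comparison function
    -- `exp (2 k T) / (2 k) - (M + 1) exp (k T)` diverges while `(f - (M + 1)) exp (k T) ≤ 0`.
    have hX : Tendsto (fun r => Real.exp (k * T r)) atTop atTop :=
      Real.tendsto_exp_atTop.comp (hT.tendsto_atTop.const_mul_atTop hk)
    have hlim : Tendsto (fun r => Real.exp (2 * k * T r) / (2 * k)
        - (M + 1) * Real.exp (k * T r)) atTop atTop := by
      have h1 : Tendsto (fun r => Real.exp (k * T r) * (1 / (2 * k)) - (M + 1)) atTop atTop :=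
        tendsto_atTop_add_const_right _ _ (hX.atTop_mul_const (by positivity))
      refine (hX.atTop_mul_atTop₀ h1).congr fun r => ?_
      have : Real.exp (2 * k * T r) = Real.exp (k * T r) * Real.exp (k * T r) := by
        rw [← Real.exp_add]; congr 1; ring
      rw [this]
      ring
    have hlim2 := tendsto_atTop_of_hasDerivAt_le (R := S)
      (fun r hr => ((hasDerivAt_exp_mul hT.hasDerivAt (2 * k) (hS r hr).2).div_const (2 * k)).sub
        ((hasDerivAt_exp_mul hT.hasDerivAt k (hS r hr).2).const_mul (M + 1)))
      (fun r hr => (hE r (hS r hr).2).sub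
        ((hasDerivAt_exp_mul hT.hasDerivAt k (hS r hr).2).const_mul (M + 1)))
      (fun r hr => by
        refine sub_le_sub_right (le_of_eq_of_le ?_ (hle r hr)) _
        field_simp) hlim
    obtain ⟨r, hr, hr0⟩ := ((hlim2.eventually_gt_atTop 0).and (eventually_gt_atTop 0)).exists
    have h1 := (le_abs_self _).trans (hM r hr0)
    have h2 := Real.exp_pos (k * T r)
    simp only [Pi.sub_apply] at hr
    nlinarith

/-- The one-dimensional form of the theorem: a bounded radial factor whose Laplacian is a
homogeneous radial factor, bounded at the origin, is constant, and vanishes unless `k = 0`. -/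
lemma IsRadialSolution.exists_eq_const (hf : IsRadialSolution φ k f g)
    (hg : IsRadialSolution φ k g 0) (hk : 0 ≤ k)
    (hpos : ∀ r, 0 < r → 0 < φ r) (hd : ∀ r, 0 < r → DifferentiableAt ℝ φ r)
    (hT : IsConformalRadius φ T) (hinf : Tendsto φ atTop atTop) {M N : ℝ}
    (hM : ∀ r, 0 < r → |f r| ≤ M) (hN : ∀ᶠ r in 𝓝[>] (0 : ℝ), |g r| ≤ N) :
    ∃ c, (∀ r, 0 < r → f r = c) ∧ (0 < k → c = 0) := by
  obtain ⟨a, ha⟩ := hg.eq_mul_exp hk hpos hd hT hN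
  have hf' : IsRadialSolution φ k f fun r => a * Real.exp (k * T r) :=
    ⟨hf.1, hf.2, fun r hr => by rw [hf.3 r hr, ha r hr]⟩
  have ha0 : a = 0 := by
    rcases lt_trichotomy a 0 with h | h | h
    · refine (IsRadialSolution.false_of_pos (a := -a) (f := fun r => -f r) (by linarith) ?_ hk hpos
        hd hT hinf (M := M) (by simpa using hM)).elim
      simpa using hf'.neg
    · exact h
    · exact (hf'.false_of_pos h hk hpos hd hT hinf hM).elim
  have hf0 : IsRadialSolution φ k f 0 :=
    ⟨hf.1, hf.2, fun r hr => by rw [hf'.3 r hr, ha0]; simp⟩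
  obtain ⟨c, hc⟩ := hf0.eq_mul_exp hk hpos hd hT
    (eventually_mem_nhdsWithin.mono fun r hr => hM r hr)
  rcases hk.eq_or_lt with rfl | hk
  · exact ⟨c, by simpa using hc, fun h => (lt_irrefl _ h).elim⟩
  · have hc0 : c = 0 := by
      refine eq_zero_of_abs_mul_add_le (c := 0) (M := M) (X := fun r => Real.exp (k * T r))
        (Real.tendsto_exp_atTop.comp (hT.tendsto_atTop.const_mul_atTop hk)) ?_
      filter_upwards [eventually_gt_atTop 0] with r hr
      rw [add_zero, ← hc r hr]
      exact hM r hr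
    exact ⟨0, fun r hr => by rw [hc r hr, hc0, zero_mul], fun _ => rfl⟩

/-! ### Parabolicity -/

lemma IsSmoothProfile.contDiffAt (hφ : IsSmoothProfile φ) {r : ℝ} (hr : 0 < r) :
    ContDiffAt ℝ (⊤ : ℕ∞) φ r :=
  hφ.contDiffOn.contDiffAt (Ici_mem_nhds hr)

lemma IsSmoothProfile.differentiableAt (hφ : IsSmoothProfile φ) {r : ℝ} (hr : 0 < r) :
    DifferentiableAt ℝ φ r :=
  (hφ.contDiffAt hr).differentiableAt (by simp)

lemma IsSmoothProfile.differentiableAt_deriv (hφ : IsSmoothProfile φ) {r : ℝ} (hr : 0 < r) :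
    DifferentiableAt ℝ (deriv φ) r :=
  ((hφ.contDiffAt hr).derivWithin (m := 1) (by norm_cast)).differentiableAt (by simp)

lemma IsSmoothProfile.eventually_le_two_mul (hφ : IsSmoothProfile φ) :
    ∀ᶠ r in 𝓝[>] (0 : ℝ), φ r ≤ 2 * r := by
  have h : HasDerivWithinAt φ 1 (Ici 0) 0 := by
    rw [← hφ.deriv_zero]
    exact ((hφ.contDiffOn.differentiableOn (by simp)) 0 self_mem_Ici).hasDerivWithinAt
  have h2 := (hasDerivWithinAt_iff_tendsto_slope.1 h).eventually_le_const (u := 2) (by norm_num)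
  rw [Ici_sdiff_left] at h2
  filter_upwards [h2, eventually_mem_nhdsWithin] with r hr hr0
  have hr0 : 0 < r := hr0
  rw [slope_def_field, hφ.map_zero, sub_zero, sub_zero, div_le_iff₀ hr0] at hr
  exact hr

/-- Sturm comparison with `ψ(r) = r log r`, whose curvature is `-1 / (r² log r)`. With the
Wronskian `w = φ' ψ - φ ψ'`, the curvature bound gives `w' ≤ 0`, so `(φ/ψ)' = w/ψ²` is at most
a multiple of `1/r²` and `φ/ψ` is bounded. -/
lemma IsSmoothProfile.exists_le_mul_log (hφ : IsSmoothProfile φ) {R : ℝ}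
    (hK : ∀ r, R ≤ r → -(1 / (r ^ 2 * Real.log r)) ≤ curvature φ r) :
    ∃ C S : ℝ, 0 < C ∧ Real.exp 1 ≤ S ∧ ∀ r, S ≤ r → φ r ≤ C * (r * Real.log r) := by
  set S := max R (Real.exp 1) with hS
  have he : ∀ r, S ≤ r → Real.exp 1 ≤ r := fun r hr => (le_max_right _ _).trans hr
  have h0 : ∀ r, S ≤ r → 0 < r := fun r hr => (Real.exp_pos 1).trans_le (he r hr)
  have hl : ∀ r, S ≤ r → 1 ≤ Real.log r := fun r hr =>
    (Real.le_log_iff_exp_le (h0 r hr)).2 (he r hr)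
  have hψ : ∀ r, S ≤ r → HasDerivAt (fun r => r * Real.log r) (Real.log r + 1) r :=
    fun r hr => Real.hasDerivAt_mul_log (h0 r hr).ne'
  set w := fun r => deriv φ r * (r * Real.log r) - φ r * (Real.log r + 1) with hw
  have hwd : ∀ r, S ≤ r → HasDerivAt w (deriv (deriv φ) r * (r * Real.log r) - φ r / r) r := by
    intro r hr
    refine (((hφ.differentiableAt_deriv (h0 r hr)).hasDerivAt.mul (hψ r hr)).sub
      ((hφ.differentiableAt (h0 r hr)).hasDerivAt.mul
        ((Real.hasDerivAt_log (h0 r hr).ne').add_const 1))).congr_deriv ?_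
    ring
  have hwle : ∀ r, S ≤ r → w r ≤ |w S| := by
    intro r hr
    have hm : MonotoneOn (fun r => -w r) (Ici S) :=
      monotoneOn_of_hasDerivAt_nonneg (convex_Ici S) (fun r hr => (hwd r hr).neg) fun r hr => by
        have hr0 := h0 r hr
        have hl0 : 0 < Real.log r := one_pos.trans_le (hl r hr)
        have hp := hφ.pos r hr0
        have hc := hK r ((le_max_left _ _).trans hr)
        rw [curvature, neg_le_neg_iff, div_le_iff₀ hp] at hc
        have : deriv (deriv φ) r * (r * Real.log r) ≤ φ r / r := by
          calc _ ≤ 1 / (r ^ 2 * Real.log r) * φ r * (r * Real.log r) := by gcongr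
            _ = φ r / r := by field_simp
        linarith
    have := hm self_mem_Ici hr hr
    simp only [neg_le_neg_iff] at this
    exact this.trans (le_abs_self _)
  -- `φ/ψ + |w(S)|/r` is nonincreasing, since `ψ ≥ r` on `[S, ∞)`.
  have hq : MonotoneOn (fun r => -(φ r / (r * Real.log r) + |w S| * r⁻¹)) (Ici S) := by
    refine monotoneOn_of_hasDerivAt_nonneg (convex_Ici S) (fun r hr =>
      (((hφ.differentiableAt (h0 r hr)).hasDerivAt.div (hψ r hr)
        (mul_pos (h0 r hr) (one_pos.trans_le (hl r hr))).ne').add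
        ((hasDerivAt_inv (h0 r hr).ne').const_mul _)).neg) fun r hr => ?_
    have hr0 := h0 r hr
    have h1 : (deriv φ r * (r * Real.log r) - φ r * (Real.log r + 1)) / (r * Real.log r) ^ 2
        ≤ |w S| / r ^ 2 := by
      refine div_le_div₀ (abs_nonneg _) (hwle r hr) (by positivity) ?_
      have : r ≤ r * Real.log r := le_mul_of_one_le_right hr0.le (hl r hr)
      gcongr
    have h2 : |w S| * -(r ^ 2)⁻¹ = -(|w S| / r ^ 2) := by ring
    rw [h2]
    linarith
  refine ⟨|φ S / (S * Real.log S) + |w S| * S⁻¹| + 1, S, by positivity, le_max_right _ _,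
    fun r hr => ?_⟩
  have h1 := hq self_mem_Ici hr hr
  have hr0 := h0 r hr
  have hl0 : 0 < Real.log r := one_pos.trans_le (hl r hr)
  have h3 : 0 ≤ |w S| * r⁻¹ := by positivity
  simp only [neg_le_neg_iff] at h1
  rw [← div_le_iff₀ (by positivity)]
  linarith [le_abs_self (φ S / (S * Real.log S) + |w S| * S⁻¹)]

/-- The curvature bound makes the surface parabolic (Milnor's criterion): `1/φ` is not integrable
at infinity, because `1 / (r log r)` is not. -/
lemma IsSmoothProfile.exists_isConformalRadius (hφ : IsSmoothProfile φ) {R : ℝ}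
    (hK : ∀ r, R ≤ r → -(1 / (r ^ 2 * Real.log r)) ≤ curvature φ r) :
    ∃ T, IsConformalRadius φ T := by
  have hcont : ContinuousOn (fun r => 1 / φ r) (Ioi 0) := fun r hr =>
    (continuousAt_const.div (hφ.differentiableAt hr).continuousAt
      (hφ.pos r hr).ne').continuousWithinAt
  set T := fun r => ∫ s in (1 : ℝ)..r, 1 / φ s with hTdef
  have hT : ∀ r, 0 < r → HasDerivAt T (1 / φ r) r := fun r hr => by
    refine intervalIntegral.integral_hasDerivAt_right ?_ ?_
      (hcont.continuousAt (Ioi_mem_nhds hr))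
    · refine (hcont.mono ?_).intervalIntegrable
      intro x hx
      exact (lt_min one_pos hr).trans_le hx.1
    · exact hcont.stronglyMeasurableAtFilter isOpen_Ioi r hr
  refine ⟨T, hT, ?_, ?_⟩
  · obtain ⟨δ, hδ, hle⟩ := mem_nhdsGT_iff_exists_Ioc_subset.1 hφ.eventually_le_two_mul
    have hδ : 0 < δ := hδ
    have hm : MonotoneOn (fun r => T r - Real.log r / 2) (Ioc 0 δ) := by
      refine monotoneOn_of_hasDerivAt_nonneg (convex_Ioc 0 δ) (fun r hr =>
        (hT r hr.1).sub ((Real.hasDerivAt_log hr.1.ne').div_const 2)) fun r hr => ?_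
      have h1 : φ r ≤ 2 * r := hle hr
      have := one_div_le_one_div_of_le (hφ.pos r hr.1) h1
      have h2 : r⁻¹ / 2 = 1 / (2 * r) := by field_simp
      rw [h2]
      linarith
    have hlog : Tendsto (fun r => Real.log r / 2 + (T δ - Real.log δ / 2)) (𝓝[>] 0) atBot :=
      tendsto_atBot_add_const_right _ _
        (Real.tendsto_log_nhdsGT_zero.atBot_div_const (by norm_num))
    refine tendsto_atBot_mono' _ ?_ hlog
    filter_upwards [Ioc_mem_nhdsGT hδ] with r hr
    have := hm hr ⟨hδ, le_rfl⟩ hr.2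
    simp only at this
    linarith
  · obtain ⟨C, S, hC, hS, hle⟩ := hφ.exists_le_mul_log hK
    have h0 : ∀ r, S ≤ r → 0 < r := fun r hr => (Real.exp_pos 1).trans_le (hS.trans hr)
    have hl : ∀ r, S ≤ r → 1 ≤ Real.log r := fun r hr =>
      (Real.le_log_iff_exp_le (h0 r hr)).2 (hS.trans hr)
    refine tendsto_atTop_of_hasDerivAt_le (R := S)
      (fun r hr => ((Real.hasDerivAt_log (h0 r hr).ne').log
        (one_pos.trans_le (hl r hr)).ne').const_mul C⁻¹) (fun r hr => hT r (h0 r hr))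
      (fun r hr => ?_)
      ((Real.tendsto_log_atTop.comp Real.tendsto_log_atTop).const_mul_atTop (inv_pos.2 hC))
    have hr0 := h0 r hr
    have hl0 : 0 < Real.log r := one_pos.trans_le (hl r hr)
    calc _ = 1 / (C * (r * Real.log r)) := by field_simp
      _ ≤ 1 / φ r := one_div_le_one_div_of_le (hφ.pos r hr0) (hle r hr)

variable {u : Plane → ℝ}

/-! ### Polar coordinates -/

/-- The point with polar coordinates `(r, θ)`. -/
def polarPt (r θ : ℝ) : Plane := !₂[r * Real.cos θ, r * Real.sin θ]

/-- The function `u` in polar coordinates, as a function on `ℝ × ℝ`; negative radii are allowed. -/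
def polarLift (u : Plane → ℝ) (q : ℝ × ℝ) : ℝ := u (polarPt q.1 q.2)

/-- The partial derivative of a function on `ℝ × ℝ` in the first variable. -/
def partialFst (W : ℝ × ℝ → ℝ) (q : ℝ × ℝ) : ℝ := fderiv ℝ W q (1, 0)

/-- The partial derivative of a function on `ℝ × ℝ` in the second variable. -/
def partialSnd (W : ℝ × ℝ → ℝ) (q : ℝ × ℝ) : ℝ := fderiv ℝ W q (0, 1)

section Partial

variable {W : ℝ × ℝ → ℝ}

lemma hasDerivAt_partialFst (hW : ContDiff ℝ 1 W) (r θ : ℝ) :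
    HasDerivAt (fun s => W (s, θ)) (partialFst W (r, θ)) r :=
  ((hW.differentiable one_ne_zero) (r, θ)).hasFDerivAt.comp_hasDerivAt r
    ((hasDerivAt_id r).prodMk (hasDerivAt_const r θ))

lemma hasDerivAt_partialSnd (hW : ContDiff ℝ 1 W) (r θ : ℝ) :
    HasDerivAt (fun t => W (r, t)) (partialSnd W (r, θ)) θ :=
  ((hW.differentiable one_ne_zero) (r, θ)).hasFDerivAt.comp_hasDerivAt θ
    ((hasDerivAt_const θ r).prodMk (hasDerivAt_id θ))

lemma contDiff_partialFst {n : ℕ∞} (hW : ContDiff ℝ (n + 1) W) : ContDiff ℝ n (partialFst W) :=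
  (hW.fderiv_right le_rfl).clm_apply contDiff_const

lemma contDiff_partialSnd {n : ℕ∞} (hW : ContDiff ℝ (n + 1) W) : ContDiff ℝ n (partialSnd W) :=
  (hW.fderiv_right le_rfl).clm_apply contDiff_const

end Partial

lemma norm_polarPt {r : ℝ} (hr : 0 ≤ r) (θ : ℝ) : ‖polarPt r θ‖ = r := by
  rw [EuclideanSpace.norm_eq, Real.sqrt_eq_iff_mul_self_eq (by positivity) hr]
  simp only [polarPt, Fin.sum_univ_two, Real.norm_eq_abs, sq_abs]
  simp
  linear_combination r ^ 2 * Real.sin_sq_add_cos_sq θ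

lemma polarPt_ne_zero {r : ℝ} (hr : 0 < r) (θ : ℝ) : polarPt r θ ≠ 0 := by
  rw [← norm_pos_iff, norm_polarPt hr.le]
  exact hr

lemma smul_polarPt (c r θ : ℝ) : c • polarPt r θ = polarPt (c * r) θ := by
  ext i
  fin_cases i <;> simp [polarPt, mul_assoc]

lemma rot_polarPt (t r θ : ℝ) : rot t (polarPt r θ) = polarPt r (θ + t) := by
  ext i
  fin_cases i
  · simp [polarPt, rot, Real.cos_add]; ring
  · simp [polarPt, rot, Real.sin_add]; ring

lemma contDiff_polarPt {n : ℕ∞} : ContDiff ℝ n fun q : ℝ × ℝ => polarPt q.1 q.2 := by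
  rw [contDiff_euclidean]
  intro i
  fin_cases i
  · exact contDiff_fst.mul (Real.contDiff_cos.comp contDiff_snd)
  · exact contDiff_fst.mul (Real.contDiff_sin.comp contDiff_snd)

lemma exists_polarPt_eq (p : Plane) : ∃ θ, polarPt ‖p‖ θ = p := by
  refine ⟨Complex.arg ⟨p 0, p 1⟩, ?_⟩
  have h : ‖(⟨p 0, p 1⟩ : ℂ)‖ = ‖p‖ := by
    rw [EuclideanSpace.norm_eq, Complex.norm_eq_sqrt_sq_add_sq]
    simp [Fin.sum_univ_two]
  ext i
  fin_cases i
  · simpa [polarPt, h] using Complex.norm_mul_cos_arg ⟨p 0, p 1⟩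
  · simpa [polarPt, h] using Complex.norm_mul_sin_arg ⟨p 0, p 1⟩

lemma contDiff_polarLift {n : ℕ∞} (hu : ContDiff ℝ n u) : ContDiff ℝ n (polarLift u) :=
  hu.comp contDiff_polarPt

lemma polarLift_two_pi (u : Plane → ℝ) (r θ : ℝ) :
    polarLift u (r, θ + 2 * Real.pi) = polarLift u (r, θ) := by
  simp [polarLift, polarPt]

lemma dr_polarPt (u : Plane → ℝ) {r : ℝ} (hr : 0 < r) (θ : ℝ) :
    dr u (polarPt r θ) = deriv (fun s => u (polarPt s θ)) r := by
  simp only [dr, norm_polarPt hr.le, smul_polarPt]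
  simp [hr.ne']

lemma dθ_polarPt (u : Plane → ℝ) (r θ : ℝ) :
    dθ u (polarPt r θ) = deriv (fun t => u (polarPt r t)) θ := by
  simp only [dθ, rot_polarPt]
  rw [deriv_comp_const_add (f := fun t => u (polarPt r t)), add_zero]

lemma laplacian_polarPt (hu : ContDiff ℝ 2 u) {r : ℝ} (hr : 0 < r) (θ : ℝ) :
    laplacian φ u (polarPt r θ) = partialFst (partialFst (polarLift u)) (r, θ)
      + deriv φ r / φ r * partialFst (polarLift u) (r, θ)
      + 1 / φ r ^ 2 * partialSnd (partialSnd (polarLift u)) (r, θ) := by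
  have hU : ContDiff ℝ ((1 : ℕ∞) + 1) (polarLift u) := by
    convert contDiff_polarLift (n := 2) hu using 1
    norm_num
  have hU1 : ContDiff ℝ 1 (polarLift u) := hU.of_le (by norm_num)
  have h1 : ∀ s, 0 < s → dr u (polarPt s θ) = partialFst (polarLift u) (s, θ) := fun s hs => by
    rw [dr_polarPt u hs]
    exact (hasDerivAt_partialFst hU1 s θ).deriv
  have h2 : ∀ t, dθ u (polarPt r t) = partialSnd (polarLift u) (r, t) := fun t => by
    rw [dθ_polarPt]
    exact (hasDerivAt_partialSnd hU1 r t).deriv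
  rw [laplacian, if_neg (polarPt_ne_zero hr θ), polarLaplacian, norm_polarPt hr.le, h1 r hr,
    dr_polarPt _ hr, dθ_polarPt]
  congr 2
  · refine EventuallyEq.deriv_eq (f := fun s => partialFst (polarLift u) (s, θ)) ?_ |>.trans
      (hasDerivAt_partialFst (contDiff_partialFst hU) r θ).deriv
    filter_upwards [Ioi_mem_nhds hr] with s hs using h1 s hs
  · simp only [h2]
    exact (hasDerivAt_partialSnd (contDiff_partialSnd hU) r θ).deriv

/-! ### Fourier modes -/

lemma hasDerivAt_integral_of_continuous {F F' : ℝ × ℝ → ℝ} (hF : Continuous F)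
    (hF' : Continuous F') (h : ∀ r θ, HasDerivAt (fun s => F (s, θ)) (F' (r, θ)) r) (a b r : ℝ) :
    HasDerivAt (fun s => ∫ θ in a..b, F (s, θ)) (∫ θ in a..b, F' (r, θ)) r := by
  obtain ⟨C, hC⟩ := ((isCompact_Icc (a := r - 1) (b := r + 1)).prod
    (isCompact_uIcc (a := a) (b := b))).exists_bound_of_continuousOn hF'.continuousOn
  refine (intervalIntegral.hasDerivAt_integral_of_dominated_loc_of_deriv_le
    (F := fun s θ => F (s, θ)) (F' := fun s θ => F' (s, θ)) (bound := fun _ => C)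
    (Icc_mem_nhds (sub_one_lt r) (lt_add_one r)) (Eventually.of_forall fun s => ?_)
    ?_ ?_ (Eventually.of_forall fun θ hθ s hs => hC (s, θ) ⟨hs, uIoc_subset_uIcc hθ⟩)
    intervalIntegrable_const (Eventually.of_forall fun θ _ s _ => h s θ)).2
  · exact (hF.comp (by fun_prop : Continuous fun θ : ℝ => (s, θ))).aestronglyMeasurable
  · exact (hF.comp (by fun_prop : Continuous fun θ : ℝ => (r, θ))).intervalIntegrable _ _
  · exact (hF'.comp (by fun_prop : Continuous fun θ : ℝ => (r, θ))).aestronglyMeasurable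

/-- The coefficient of `u` on the circle of radius `r` against `cos (kθ + α)`, unnormalized. The
phases `α = 0` and `α = -π/2` give the cosine and the sine coefficients. -/
def mode (u : Plane → ℝ) (k : ℕ) (α r : ℝ) : ℝ :=
  ∫ θ in (0 : ℝ)..2 * Real.pi, polarLift u (r, θ) * Real.cos (k * θ + α)

lemma hasDerivAt_cos_phase (k : ℕ) (α θ : ℝ) :
    HasDerivAt (fun θ => Real.cos (k * θ + α)) (-(k * Real.sin (k * θ + α))) θ := by
  have h := (((hasDerivAt_id θ).const_mul (k : ℝ)).add_const α).cos
  exact h.congr_deriv (by simp; ring)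

lemma hasDerivAt_sin_phase (k : ℕ) (α θ : ℝ) :
    HasDerivAt (fun θ => Real.sin (k * θ + α)) (k * Real.cos (k * θ + α)) θ := by
  have h := (((hasDerivAt_id θ).const_mul (k : ℝ)).add_const α).sin
  exact h.congr_deriv (by simp; ring)

/-- Two integrations by parts over the circle: the derivative of
`W' cos (kθ + α) + k W sin (kθ + α)` is `W'' cos (kθ + α) + k² W cos (kθ + α)`. -/
lemma integral_deriv_deriv_mul_cos {W W' W'' : ℝ → ℝ} (hW : ∀ θ, HasDerivAt W (W' θ) θ)
    (hW' : ∀ θ, HasDerivAt W' (W'' θ) θ) (hc : Continuous W'')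
    (hper : W (2 * Real.pi) = W 0) (hper' : W' (2 * Real.pi) = W' 0) (k : ℕ) (α : ℝ) :
    ∫ θ in (0 : ℝ)..2 * Real.pi, W'' θ * Real.cos (k * θ + α)
      = -k ^ 2 * ∫ θ in (0 : ℝ)..2 * Real.pi, W θ * Real.cos (k * θ + α) := by
  have hWc : Continuous W := continuous_iff_continuousAt.2 fun θ => (hW θ).continuousAt
  have hd : ∀ θ ∈ uIcc 0 (2 * Real.pi),
      HasDerivAt (fun θ => W' θ * Real.cos (k * θ + α) + W θ * (k * Real.sin (k * θ + α)))
      (W'' θ * Real.cos (k * θ + α) + k ^ 2 * (W θ * Real.cos (k * θ + α))) θ := fun θ _ => by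
    refine (((hW' θ).mul (hasDerivAt_cos_phase k α θ)).add
      ((hW θ).mul ((hasDerivAt_sin_phase k α θ).const_mul (k : ℝ)))).congr_deriv ?_
    ring
  have h := intervalIntegral.integral_eq_sub_of_hasDerivAt hd
    (Continuous.intervalIntegrable (by fun_prop) _ _)
  have hcos : Real.cos (k * (2 * Real.pi) + α) = Real.cos (k * 0 + α) := by
    rw [add_comm, Real.cos_add_nat_mul_two_pi]; simp
  have hsin : Real.sin (k * (2 * Real.pi) + α) = Real.sin (k * 0 + α) := by
    rw [add_comm, Real.sin_add_nat_mul_two_pi]; simp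
  rw [hcos, hsin, hper, hper', sub_self, intervalIntegral.integral_add
    (Continuous.intervalIntegrable (by fun_prop) _ _)
    (Continuous.intervalIntegrable (by fun_prop) _ _), intervalIntegral.integral_const_mul] at h
  linarith

lemma isRadialSolution_mode (hφ : IsSmoothProfile φ) (hu : ContDiff ℝ 2 u) (k : ℕ) (α : ℝ) :
    IsRadialSolution φ k (mode u k α) (mode (laplacian φ u) k α) := by
  have hU : ContDiff ℝ ((1 : ℕ∞) + 1) (polarLift u) := by
    convert contDiff_polarLift (n := 2) hu using 1
    norm_num
  have hU1 : ContDiff ℝ 1 (polarLift u) := hU.of_le (by norm_num)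
  have hUr : ContDiff ℝ ((0 : ℕ∞) + 1) (partialFst (polarLift u)) := by
    simpa using contDiff_partialFst hU
  have hUt : ContDiff ℝ ((0 : ℕ∞) + 1) (partialSnd (polarLift u)) := by
    simpa using contDiff_partialSnd hU
  have hUr1 : ContDiff ℝ 1 (partialFst (polarLift u)) := by simpa using hUr
  have hUt1 : ContDiff ℝ 1 (partialSnd (polarLift u)) := by simpa using hUt
  have c0 : Continuous (polarLift u) := hU.continuous
  have c1 : Continuous (partialFst (polarLift u)) := hUr.continuous
  have c2 : Continuous (partialFst (partialFst (polarLift u))) :=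
    (contDiff_partialFst hUr).continuous
  have c3 : Continuous (partialSnd (partialSnd (polarLift u))) :=
    (contDiff_partialSnd hUt).continuous
  have d1 : ∀ r, HasDerivAt (mode u k α) (∫ θ in (0 : ℝ)..2 * Real.pi,
      partialFst (polarLift u) (r, θ) * Real.cos (k * θ + α)) r := fun r =>
    hasDerivAt_integral_of_continuous (F := fun q => polarLift u q * Real.cos (k * q.2 + α))
      (F' := fun q => partialFst (polarLift u) q * Real.cos (k * q.2 + α))
      (by fun_prop) (by fun_prop) (fun r θ => (hasDerivAt_partialFst hU1 r θ).mul_const (Real.cos (k * θ + α))) _ _ r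
  have d2 : ∀ r, HasDerivAt (deriv (mode u k α)) (∫ θ in (0 : ℝ)..2 * Real.pi,
      partialFst (partialFst (polarLift u)) (r, θ) * Real.cos (k * θ + α)) r := fun r => by
    rw [funext fun r => (d1 r).deriv]
    exact hasDerivAt_integral_of_continuous
      (F := fun q => partialFst (polarLift u) q * Real.cos (k * q.2 + α))
      (F' := fun q => partialFst (partialFst (polarLift u)) q * Real.cos (k * q.2 + α))
      (by fun_prop) (by fun_prop) (fun r θ => (hasDerivAt_partialFst hUr1 r θ).mul_const (Real.cos (k * θ + α))) _ _ r
  refine ⟨fun r _ => (d1 r).differentiableAt, fun r _ => (d2 r).differentiableAt, fun r hr => ?_⟩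
  have hper : ∀ θ, polarLift u (r, θ + 2 * Real.pi) = polarLift u (r, θ) := polarLift_two_pi u r
  have hper' : partialSnd (polarLift u) (r, 2 * Real.pi) = partialSnd (polarLift u) (r, 0) := by
    have h := (hasDerivAt_partialSnd hU1 r (0 + 2 * Real.pi)).comp_add_const 0 (2 * Real.pi)
    simp only [hper, zero_add] at h
    exact h.unique (hasDerivAt_partialSnd hU1 r 0)
  have hparts := integral_deriv_deriv_mul_cos (fun θ => hasDerivAt_partialSnd hU1 r θ)
    (fun θ => hasDerivAt_partialSnd hUt1 r θ) (by fun_prop) (by simpa using hper 0) hper' k α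
  have hp := (hφ.pos r hr).ne'
  rw [(d1 r).deriv, (d2 r).deriv]
  have hrhs : φ r ^ 2 * mode (laplacian φ u) k α r = ∫ θ in (0 : ℝ)..2 * Real.pi,
      (φ r ^ 2 * (partialFst (partialFst (polarLift u)) (r, θ) * Real.cos (k * θ + α))
        + φ r * deriv φ r * (partialFst (polarLift u) (r, θ) * Real.cos (k * θ + α))
        + partialSnd (partialSnd (polarLift u)) (r, θ) * Real.cos (k * θ + α)) := by
    rw [mode, ← intervalIntegral.integral_const_mul]
    congr 1
    funext θ
    rw [polarLift, laplacian_polarPt hu hr]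
    field_simp
  rw [hrhs, intervalIntegral.integral_add (Continuous.intervalIntegrable (by fun_prop) _ _)
    (Continuous.intervalIntegrable (by fun_prop) _ _),
    intervalIntegral.integral_add (Continuous.intervalIntegrable (by fun_prop) _ _)
    (Continuous.intervalIntegrable (by fun_prop) _ _), intervalIntegral.integral_const_mul,
    intervalIntegral.integral_const_mul, hparts, mode]
  ring

lemma abs_mode_le {M : ℝ} {r : ℝ} (hM : ∀ θ, |u (polarPt r θ)| ≤ M) (k : ℕ) (α : ℝ) :
    |mode u k α r| ≤ M * (2 * Real.pi) := by
  have h := intervalIntegral.norm_integral_le_of_norm_le_const (a := 0) (b := 2 * Real.pi)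
    (f := fun θ => polarLift u (r, θ) * Real.cos (k * θ + α)) (C := M) fun θ _ => by
      rw [norm_mul, Real.norm_eq_abs, Real.norm_eq_abs]
      exact (mul_le_of_le_one_right (abs_nonneg _) (Real.abs_cos_le_one _)).trans (hM θ)
  rwa [sub_zero, abs_of_pos Real.two_pi_pos] at h

lemma exists_eventually_abs_mode_le (hu : Continuous u) (k : ℕ) (α : ℝ) :
    ∃ N, ∀ᶠ r in 𝓝[>] (0 : ℝ), |mode u k α r| ≤ N := by
  obtain ⟨C, hC⟩ := (isCompact_closedBall (0 : Plane) 1).exists_bound_of_continuousOn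
    hu.continuousOn
  refine ⟨C * (2 * Real.pi), ?_⟩
  filter_upwards [Ioc_mem_nhdsGT one_pos] with r hr
  refine abs_mode_le (fun θ => hC _ ?_) k α
  rw [mem_closedBall_zero_iff, norm_polarPt hr.1.le]
  exact hr.2

/-- A continuous `2π`-periodic function is its Fourier series as soon as the latter is summable;
here all coefficients but the mean vanish. -/
lemma eq_mean_of_integral_mul_cos_eq_zero {F : ℝ → ℝ} (hF : Continuous F)
    (hper : Function.Periodic F (2 * Real.pi))
    (h : ∀ (k : ℕ) (α : ℝ), 0 < k →
      ∫ θ in (0 : ℝ)..2 * Real.pi, F θ * Real.cos (k * θ + α) = 0) (θ : ℝ) :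
    F θ = (2 * Real.pi)⁻¹ * ∫ θ in (0 : ℝ)..2 * Real.pi, F θ := by
  have : Fact (0 < 2 * Real.pi) := ⟨Real.two_pi_pos⟩
  set G : C(AddCircle (2 * Real.pi), ℂ) :=
    ⟨fun x => (hper.lift x : ℂ), Complex.continuous_ofReal.comp
      (continuous_coinduced_dom.2 hF)⟩ with hG
  have hGF : ∀ x : ℝ, G x = (F x : ℂ) := fun x => rfl
  have hcoeff : ∀ n : ℤ, fourierCoeff G n
      = (1 / (2 * Real.pi)) • (((∫ x in (0 : ℝ)..2 * Real.pi, F x * Real.cos (n * x) : ℝ) : ℂ)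
        - ((∫ x in (0 : ℝ)..2 * Real.pi, F x * Real.sin (n * x) : ℝ) : ℂ) * Complex.I) := by
    intro n
    rw [fourierCoeff_eq_intervalIntegral _ _ 0, zero_add, ← intervalIntegral.integral_ofReal,
      ← intervalIntegral.integral_ofReal, ← intervalIntegral.integral_mul_const,
      ← intervalIntegral.integral_sub (Continuous.intervalIntegrable (by fun_prop) _ _)
      (Continuous.intervalIntegrable (by fun_prop) _ _)]
    congr 2
    funext x
    have hexp : (2 * Real.pi * Complex.I * ((-n : ℤ) : ℂ) * x / ((2 * Real.pi : ℝ) : ℂ) : ℂ)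
        = ((-(n * x) : ℝ) : ℂ) * Complex.I := by
      have : (Real.pi : ℂ) ≠ 0 := by exact_mod_cast Real.pi_ne_zero
      push_cast
      field_simp
    rw [hGF, fourier_coe_apply, hexp, Complex.exp_mul_I, ← Complex.ofReal_cos,
      ← Complex.ofReal_sin, Real.cos_neg, Real.sin_neg, smul_eq_mul]
    push_cast
    ring
  have hzero : ∀ n : ℤ, n ≠ 0 → fourierCoeff G n = 0 := by
    intro n hn
    have hk := h n.natAbs
    have hpos : 0 < n.natAbs := Int.natAbs_pos.2 hn
    have hc : ∫ x in (0 : ℝ)..2 * Real.pi, F x * Real.cos (n * x) = 0 := by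
      refine Eq.trans ?_ (hk 0 hpos)
      congr 1; funext x
      rcases Int.natAbs_eq n with e | e <;> (rw [e]; simp)
    have hs : ∫ x in (0 : ℝ)..2 * Real.pi, F x * Real.sin (n * x) = 0 := by
      rcases Int.natAbs_eq n with e | e
      · refine Eq.trans ?_ (hk (-(Real.pi / 2)) hpos)
        congr 1; funext x
        rw [← sub_eq_add_neg, Real.cos_sub_pi_div_two, ← Int.cast_natCast, ← e]
      · refine Eq.trans ?_ (hk (Real.pi / 2) hpos)
        congr 1; funext x
        have e' : (n : ℝ) = -(n.natAbs : ℝ) := by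
          rw [← Int.cast_natCast, ← Int.cast_neg, ← e]
        rw [Real.cos_add_pi_div_two, e', neg_mul, Real.sin_neg]
    rw [hcoeff, hc, hs]
    simp
  have hsum := has_pointwise_sum_fourier_series_of_summable
    (summable_of_ne_finset_zero (s := {0}) fun n hn => hzero n (by simpa using hn))
    (θ : AddCircle (2 * Real.pi))
  have h0 := hsum.unique (hasSum_single 0 fun n hn => by rw [hzero n hn, zero_smul])
  rw [hGF, hcoeff] at h0
  simp only [fourier_zero, smul_eq_mul, mul_one, Int.cast_zero, zero_mul, Real.cos_zero,
    Real.sin_zero, mul_zero, intervalIntegral.integral_zero, Complex.ofReal_zero, sub_zero,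
    Complex.real_smul] at h0
  rw [← one_div]
  exact_mod_cast h0

end RotSym

end

theorem theorem1p2 (φ : ℝ → ℝ) (hφ : RotSym.IsSmoothProfile φ)
    (hK : ∃ C : Set RotSym.Plane, IsCompact C ∧
      ∀ p : RotSym.Plane, p ∉ C →
        -(1 / (‖p‖ ^ 2 * Real.log ‖p‖)) ≤ RotSym.curvature φ ‖p‖)
    (hinf : Tendsto φ atTop atTop)
    (u : RotSym.Plane → ℝ) (hu : RotSym.IsBiharmonic φ u)
    (hbdd : ∃ M : ℝ, ∀ p : RotSym.Plane, |u p| ≤ M) :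
    ∃ c : ℝ, ∀ p : RotSym.Plane, u p = c := by
  obtain ⟨C, hC, hK⟩ := hK
  obtain ⟨M, hM⟩ := hbdd
  obtain ⟨R, hR⟩ := hC.isBounded.subset_closedBall 0
  -- `R + 1` puts the radius strictly outside the closed ball that contains the compact set.
  obtain ⟨T, hT⟩ := hφ.exists_isConformalRadius (R := max (R + 1) 1) fun r hr => by
    have hr0 : 0 ≤ r := zero_le_one.trans ((le_max_right _ _).trans hr)
    have hn := RotSym.norm_polarPt hr0 0
    have := hK (RotSym.polarPt r 0) fun hmem => by
      have h1 := mem_closedBall_zero_iff.1 (hR hmem)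
      rw [hn] at h1
      linarith [(le_max_left _ _).trans hr]
    rwa [hn] at this
  -- Every mode of nonzero frequency vanishes, and the mean over the circles is constant in `r`.
  have hmode : ∀ (k : ℕ) (α : ℝ), ∃ c, (∀ r, 0 < r → RotSym.mode u k α r = c) ∧
      ((0 : ℝ) < k → c = 0) := fun k α => by
    obtain ⟨N, hN⟩ := RotSym.exists_eventually_abs_mode_le hu.contDiff_laplacian.continuous k α
    refine (RotSym.isRadialSolution_mode hφ hu.contDiff k α).exists_eq_const ?_ k.cast_nonneg
      hφ.pos (fun r hr => hφ.differentiableAt hr) hT hinf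
      (fun r _ => RotSym.abs_mode_le (fun θ => hM _) k α) hN
    have h := RotSym.isRadialSolution_mode hφ hu.contDiff_laplacian k α
    refine ⟨h.1, h.2, fun r hr => (h.3 r hr).trans ?_⟩
    simp [RotSym.mode, RotSym.polarLift, hu.laplacian_laplacian]
  obtain ⟨c, hc, -⟩ := hmode 0 0
  have hconst : ∀ p : RotSym.Plane, p ≠ 0 → u p = (2 * Real.pi)⁻¹ * c := by
    intro p hp
    obtain ⟨θ, hθ⟩ := RotSym.exists_polarPt_eq p
    have hr := norm_pos_iff.2 hp
    have h := RotSym.eq_mean_of_integral_mul_cos_eq_zero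
      (F := fun θ => RotSym.polarLift u (‖p‖, θ))
      ((RotSym.contDiff_polarLift (n := 2) hu.contDiff).continuous.comp (by fun_prop))
      (RotSym.polarLift_two_pi u ‖p‖) (fun k α hk => by
        obtain ⟨d, hd, hd0⟩ := hmode k α
        exact (hd _ hr).trans (hd0 (by exact_mod_cast hk))) θ
    have hm := hc _ hr
    simp only [RotSym.mode, Nat.cast_zero, zero_mul, add_zero, Real.cos_zero, mul_one] at hm
    rw [hm] at h
    rw [← h, RotSym.polarLift, hθ]
  -- The origin is reached by continuity.
  have heq : u = fun _ => (2 * Real.pi)⁻¹ * c :=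
    hu.contDiff.continuous.ext_on (dense_compl_singleton (0 : RotSym.Plane)) continuous_const
      fun p hp => hconst p hp
  exact ⟨_, fun p => congrFun heq p⟩
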